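/- Let $d\ge 0$ be an integer and let $\alpha=(\alpha_1,\dots,\alpha_{d+1})\in\mathbb R^{d+1}$ be strictly increasing, $\alpha_1<\alpha_2<\dots<\alpha_{d+1}$. Write $[d+1]=\{1,\dots,d+1\}$, $\bm e_S=\sum_{i\in S}\bm e_i$ for $S\subseteq[d+1]$, $\langle\cdot,\cdot\rangle$ for the dot product, and $$U_d^\alpha=\Big\{\mathbf x\in\mathbb R^{d+1} : \sum_{i=1}^{d+1}x_i=\sum_{i=1}^{d+1}\alpha_i\Big\}.$$ For a complete binary tree $T$ (a plane rooted tree in which every internal vertex has exactly two children, a left one and a right one) with $d+1$ internal vertices, number its $d+2$ leaves $\ell_1,\dots,\ell_{d+2}$ from left to right, and for $1\le i\le d+1$ let $T_{(i)}$ be the subtree of $T$ rooted at the closest common ancestor of $\ell_i$ and $\ell_{i+1}$. Let $v_T^\alpha\in\mathbb R^{d+1}$ be the point whose $i$-th coordinate is $$\sum_{k=1}^{t}\alpha_k-\sum_{k=1}^{a}\alpha_k-\sum_{k=1}^{b}\alpha_k,$$ where $t$, $a$, $b$ are the numbers of internal vertices of $T_{(i)}$, of its left subtree and of its right subtree, respectively.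 Let $\mathrm{LodAsso}(\alpha)$ be the convex hull of the points $v_T^\alpha$, where $T$ ranges over all complete binary trees with $d+1$ internal vertices. Let $\mathscr I_d$ be the set of all integer intervals $I$ with $\emptyset\ne I\subsetneq[d+1]$, and write $\bar I=[d+1]\setminus I$. Then $$\mathrm{LodAsso}(\alpha)=\Big\{\mathbf x\in U_d^\alpha : \langle \bm e_{\bar I},\mathbf x\rangle\le\sum_{i=|I|+1}^{d+1}\alpha_i\ \text{ for all } I\in\mathscr I_d\Big\},$$ and this inequality description is minimal: $\mathrm{LodAsso}(\alpha)$ has exactly $|\mathscr I_d|$ facets, and $$I\mapsto\Big\{\mathbf x\in\mathrm{LodAsso}(\alpha) : \langle \bm e_{\bar I},\mathbf x\rangle=\sum_{i=|I|+1}^{d+1}\alpha_i\Big\}$$ is a bijection from $\mathscr I_d$ onto the set of facets of $\mathrm{LodAsso}(\alpha)$. Here a facet of a polytope $P$ is a nonempty face of $P$ of dimension $\dim P-1$, a nonempty face being the set of points of $P$ at which some linear functional attains its maximum over $P$. -/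

import Mathlib

/-! ## Polyhedra, faces, facets and minimal inequality descriptions -/

section Polyhedra

variable {n : ℕ}

/-- The dimension of a nonempty convex set `P`: the dimension of its affine span. -/
noncomputable def polyDim (P : Set (Fin n → ℝ)) : ℕ :=
  Module.finrank ℝ (vectorSpan ℝ P)

/-- `F` is a facet of `P`: a nonempty face of dimension `dim P - 1`.
A face is a set of maximizers over `P` of a linear functional, which is Mathlib's `IsExposed`
(under which the empty set also counts as a face; it has dimension `-1`
and is not regarded as a facet). -/
def IsFacet (P F : Set (Fin n → ℝ)) : Prop :=
  IsExposed ℝ P F ∧ F.Nonempty ∧ polyDim F + 1 = polyDim P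

/-- The solution set in `U` of the inequalities `⟨a i, x⟩ ≤ b i`. -/
def ineqSolutions {ι : Type} (U : Set (Fin n → ℝ)) (a : ι → Fin n → ℝ) (b : ι → ℝ) :
    Set (Fin n → ℝ) :=
  {x | x ∈ U ∧ ∀ i, a i ⬝ᵥ x ≤ b i}

/-- The finite system `⟨a i, x⟩ ≤ b i`, `i : ι`, is a minimal inequality description of `P` in
`U`: it defines `P`, the number of facets of `P` is the number of inequalities, and turning
the inequalities into equalities gives every facet of `P` exactly once. -/
structure IsMinimalIneqDescription {ι : Type} [Finite ι] (P U : Set (Fin n → ℝ))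
    (a : ι → Fin n → ℝ) (b : ι → ℝ) : Prop where
  eq_solutions : P = ineqSolutions U a b
  ncard_facets : {F | IsFacet P F}.ncard = Nat.card ι
  bijOn_facets : Set.BijOn (fun i => {x | x ∈ P ∧ a i ⬝ᵥ x = b i}) Set.univ {F | IsFacet P F}

end Polyhedra

/-! ## Complete binary trees and the Loday associahedron

A complete binary tree is a `BinaryTree Unit`: `nil` is a leaf, and each `node` is an internal
vertex with its left and right subtrees. A vector `α = (α_1, …, α_n)` is a function on `Fin n`,
with `α_k` being the value at the element `k - 1`. -/

section Loday

/-- The subtree of `T` rooted at the internal vertex labeled by `i`, which is the closest common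
ancestor of the leaves number `i` and `i + 1`, the leaves being numbered `1, 2, …` from left to
right (for `1 ≤ i ≤ T.numNodes`). -/
def subtreeAt : BinaryTree Unit → ℕ → BinaryTree Unit
  | .nil, _ => .nil
  | .node u l r, i =>
    if i + 1 ≤ l.numLeaves then
      -- both leaves lie in the left subtree
      subtreeAt l i
    else if l.numLeaves < i then
      -- both leaves lie in the right subtree
      subtreeAt r (i - l.numLeaves)
    else
      -- the two leaves are separated by the root
      .node u l r

variable {n : ℕ}

/-- The partial sum `∑_{k=1}^t α_k`. -/
def partialSum (α : Fin n → ℝ) (t : ℕ) : ℝ :=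
  ∑ k : Fin n with k.val < t, α k

/-- `val(α, T) = ∑_{k=1}^t α_k - ∑_{k=1}^a α_k - ∑_{k=1}^b α_k`, where `t`, `a`, `b` are the
numbers of internal vertices of `T`, of its left subtree and of its right subtree. -/
def treeVal (α : Fin n → ℝ) (T : BinaryTree Unit) : ℝ :=
  partialSum α T.numNodes - partialSum α T.left.numNodes - partialSum α T.right.numNodes

/-- The point `v_T^α`, whose coordinate number `i` (the element `i - 1` of `Fin n`) is the value of
the subtree rooted at the internal vertex labeled by `i`. -/
def lodayVertex (α : Fin n → ℝ) (T : BinaryTree Unit) : Fin n → ℝ :=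
  fun i => treeVal α (subtreeAt T (i.val + 1))

/-- The Loday associahedron: the convex hull of the points `v_T^α` over all complete binary trees
`T` with `n` internal vertices. -/
def LodAsso (α : Fin n → ℝ) : Set (Fin n → ℝ) :=
  convexHull ℝ {v | ∃ T : BinaryTree Unit, T.numNodes = n ∧ v = lodayVertex α T}

/-- The affine hyperplane of vectors with the same coordinate sum as `α`. -/
def sumHyperplane (α : Fin n → ℝ) : Set (Fin n → ℝ) :=
  {x | (1 : Fin n → ℝ) ⬝ᵥ x = ∑ i, α i}

/-- `e_S = ∑_{i ∈ S} e_i`. -/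
def indicatorVec (S : Finset (Fin n)) : Fin n → ℝ :=
  ∑ i ∈ S, Pi.single i 1

/-- The nonempty proper integer intervals of the index set. -/
abbrev ProperInterval (n : ℕ) : Type :=
  {I : Finset (Fin n) // (∃ a b : Fin n, I = Finset.Icc a b) ∧ I.Nonempty ∧ I ≠ Finset.univ}

end Loday

/-! Let f(t) be the sum of the first t entries of α. Since α increases, f is convex, and inside the
hyperplane the inequality of I reads: the sum of x over I is at least f(|I|).

Tree points satisfy these inequalities by induction on the tree. The sums over the two subtrees
cancel the subtracted terms at the root, and supermodularity handles an interval through the root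
(`partialSum_le_sum_treeCoord`). Conversely, a point of the polytope outside the hull would be
strictly separated from it by a linear cost. The greedy tree, rooted at a cheapest entry and built
recursively on both sides, costs no more than that point (`exists_tree_cost_le`), a contradiction.

Strict convexity gives the facets: `isMinimalIneqDescription_of_strict` needs only a strict solution
and, for each I, a solution tight at I alone. A constant vector and a two-valued vector provide
them. -/

/-! ### Facets of a polyhedron in a hyperplane -/

section Polyhedra

variable {n : ℕ} {ι : Type}

/-- The linear functional `x ↦ ⟨a, x⟩`. -/
noncomputable def dotFunctional (a : Fin n → ℝ) : (Fin n → ℝ) →ₗ[ℝ] ℝ where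
  toFun x := a ⬝ᵥ x
  map_add' := dotProduct_add a
  map_smul' r x := by simp [dotProduct_smul]

@[simp] lemma dotFunctional_apply (a x : Fin n → ℝ) : dotFunctional a x = a ⬝ᵥ x := rfl

/-- The solutions in the hyperplane `⟨u, x⟩ = c` of the inequalities `⟨a i, x⟩ ≤ b i` for which the
inequalities with index in `S` are tight. -/
def tightSolutions (u : Fin n → ℝ) (c : ℝ) (a : ι → Fin n → ℝ) (b : ι → ℝ) (S : Set ι) :
    Set (Fin n → ℝ) :=
  {x | x ∈ ineqSolutions {x | u ⬝ᵥ x = c} a b ∧ ∀ i ∈ S, a i ⬝ᵥ x = b i}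

/-- The common kernel of `u` and the `a i` for `i ∈ S`. -/
noncomputable def commonKer (u : Fin n → ℝ) (a : ι → Fin n → ℝ) (S : Set ι) :
    Submodule ℝ (Fin n → ℝ) :=
  LinearMap.ker (dotFunctional u) ⊓ ⨅ i ∈ S, LinearMap.ker (dotFunctional (a i))

lemma mem_commonKer {u : Fin n → ℝ} {a : ι → Fin n → ℝ} {S : Set ι} {w : Fin n → ℝ} :
    w ∈ commonKer u a S ↔ u ⬝ᵥ w = 0 ∧ ∀ i ∈ S, a i ⬝ᵥ w = 0 := by
  simp [commonKer, Submodule.mem_iInf]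

lemma exists_pos_forall_lt [Finite ι] (p q : ι → ℝ) (hq : ∀ i, 0 < q i) :
    ∃ ε > 0, ∀ i, ε * p i < q i := by
  have h : ∀ i, ∀ᶠ ε in nhdsWithin (0 : ℝ) (Set.Ioi 0), ε * p i < q i := by
    intro i
    have : Filter.Tendsto (fun ε : ℝ => ε * p i) (nhdsWithin 0 (Set.Ioi 0)) (nhds 0) := by
      have : Continuous fun ε : ℝ => ε * p i := by fun_prop
      simpa using (this.tendsto 0).mono_left nhdsWithin_le_nhds
    exact this.eventually_lt_const (hq i)
  obtain ⟨ε, h1, h2⟩ := ((Filter.eventually_all.2 h).and self_mem_nhdsWithin).exists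
  exact ⟨ε, h2, h1⟩

/-- At `x` the inequalities outside `S` have slack, so one can move a small positive distance along
any direction of the common kernel without leaving the set. -/
lemma vectorSpan_tightSolutions [Finite ι] {u : Fin n → ℝ} {c : ℝ} {a : ι → Fin n → ℝ}
    {b : ι → ℝ} {S : Set ι} {x : Fin n → ℝ} (hx : x ∈ tightSolutions u c a b S)
    (hlt : ∀ i ∉ S, a i ⬝ᵥ x < b i) :
    vectorSpan ℝ (tightSolutions u c a b S) = commonKer u a S := by
  apply le_antisymm
  · rw [vectorSpan_def, Submodule.span_le]
    rintro _ ⟨y, hy, z, hz, rfl⟩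
    refine mem_commonKer.2 ⟨?_, fun i hi => ?_⟩
    · beta_reduce
      rw [vsub_eq_sub, dotProduct_sub, hy.1.1, hz.1.1, sub_self]
    · beta_reduce
      rw [vsub_eq_sub, dotProduct_sub, hy.2 i hi, hz.2 i hi, sub_self]
  · intro w hw
    obtain ⟨hu, hS⟩ := mem_commonKer.1 hw
    obtain ⟨ε, hε, h⟩ := exists_pos_forall_lt (fun i : {i // i ∉ S} => a i ⬝ᵥ w)
      (fun i => b i - a i ⬝ᵥ x) (fun i => sub_pos.2 (hlt i i.2))
    have hy : x + ε • w ∈ tightSolutions u c a b S := by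
      refine ⟨⟨?_, fun i => ?_⟩, fun i hi => ?_⟩
      · have := hx.1.1
        simp only [Set.mem_ofPred_eq] at this
        simp [dotProduct_add, dotProduct_smul, hu, this]
      · by_cases hi : i ∈ S
        · simp [dotProduct_add, dotProduct_smul, hS i hi, hx.2 i hi]
        · have := h ⟨i, hi⟩
          simp only [dotProduct_add, dotProduct_smul, smul_eq_mul]
          simp only at this
          linarith
      · simp [dotProduct_add, dotProduct_smul, hS i hi, hx.2 i hi]
    have := vsub_mem_vectorSpan ℝ hy hx
    rw [vsub_eq_sub, add_sub_cancel_left] at this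
    simpa [smul_smul, hε.ne'] using Submodule.smul_mem _ ε⁻¹ this

lemma finrank_commonKer_singleton {u : Fin n → ℝ} {a : ι → Fin n → ℝ} {i : ι} {w : Fin n → ℝ}
    (hu : u ⬝ᵥ w = 0) (hw : a i ⬝ᵥ w ≠ 0) :
    Module.finrank ℝ (commonKer u a {i}) + 1 = Module.finrank ℝ (commonKer u a ∅) := by
  have hmem : w ∈ commonKer u a ∅ := mem_commonKer.2 ⟨hu, by simp⟩
  let φ : Module.Dual ℝ (commonKer u a ∅) := (dotFunctional (a i)).domRestrict _
  have hφ : φ ≠ 0 := fun h => hw (congrArg (fun f => f ⟨w, hmem⟩) h)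
  have hmap : commonKer u a {i} = (LinearMap.ker φ).map (commonKer u a ∅).subtype := by
    ext y
    simp [mem_commonKer, φ, and_comm]
  rw [hmap, Submodule.finrank_map_subtype_eq, Module.Dual.finrank_ker_add_one_of_ne_zero hφ]

lemma ineqSolutions_midpoint {u : Fin n → ℝ} {c : ℝ} {a : ι → Fin n → ℝ} {b : ι → ℝ}
    {x y : Fin n → ℝ} (hx : x ∈ ineqSolutions {x | u ⬝ᵥ x = c} a b)
    (hy : y ∈ ineqSolutions {x | u ⬝ᵥ x = c} a b) :
    (1 / 2 : ℝ) • x + (1 / 2 : ℝ) • y ∈ ineqSolutions {x | u ⬝ᵥ x = c} a b := by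
  obtain ⟨hx1, hx2⟩ := hx
  obtain ⟨hy1, hy2⟩ := hy
  simp only [Set.mem_ofPred_eq] at hx1 hy1
  refine ⟨?_, fun i => ?_⟩
  · simp only [Set.mem_ofPred_eq, dotProduct_add, dotProduct_smul, smul_eq_mul, hx1, hy1]
    ring
  · simp only [dotProduct_add, dotProduct_smul, smul_eq_mul]
    linarith [hx2 i, hy2 i]

/-- A face of a polyhedron that is contained in none of the faces cut out by a single inequality
contains a point at which all inequalities are strict. -/
lemma exists_strict_of_isExposed [Finite ι] {u : Fin n → ℝ} {c : ℝ} {a : ι → Fin n → ℝ}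
    {b : ι → ℝ} {F : Set (Fin n → ℝ)}
    (hF : IsExposed ℝ (ineqSolutions {x | u ⬝ᵥ x = c} a b) F) (hne : F.Nonempty)
    (h : ∀ i, ∃ x ∈ F, a i ⬝ᵥ x ≠ b i) : ∃ x ∈ F, ∀ i, a i ⬝ᵥ x < b i := by
  classical
  have := Fintype.ofFinite ι
  obtain ⟨l, rfl⟩ := hF hne
  suffices H : ∀ S : Finset ι, ∃ x ∈ {x | x ∈ ineqSolutions {x | u ⬝ᵥ x = c} a b ∧
      ∀ y ∈ ineqSolutions {x | u ⬝ᵥ x = c} a b, l y ≤ l x}, ∀ i ∈ S, a i ⬝ᵥ x < b i by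
    simpa using H Finset.univ
  intro S
  induction S using Finset.induction_on with
  | empty =>
    obtain ⟨x, hx⟩ := hne
    exact ⟨x, hx, by simp⟩
  | insert j S _ ih =>
    obtain ⟨x, ⟨hx, hxl⟩, hxS⟩ := ih
    obtain ⟨y, ⟨hy, hyl⟩, hyj⟩ := h j
    -- The midpoint of two maximizers is a maximizer, and it is strict wherever one of them is.
    refine ⟨_, ⟨ineqSolutions_midpoint hx hy, fun z hz => ?_⟩, fun i hi => ?_⟩
    · simp only [map_add, map_smul, smul_eq_mul]
      linarith [hxl z hz, hyl z hz]
    · have hx' := hx.2 i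
      have hy' := hy.2 i
      simp only [dotProduct_add, dotProduct_smul, smul_eq_mul]
      rcases Finset.mem_insert.1 hi with rfl | hi
      · linarith [lt_of_le_of_ne hy' hyj]
      · linarith [hxS i hi]

/-- A system of inequalities in a hyperplane is a minimal description of its solution set if it has
a strict solution and, for each inequality, a solution at which exactly that one is tight. -/
theorem isMinimalIneqDescription_of_strict [Finite ι] {u : Fin n → ℝ} {c : ℝ} {a : ι → Fin n → ℝ}
    {b : ι → ℝ}
    (h₀ : ∃ x, u ⬝ᵥ x = c ∧ ∀ i, a i ⬝ᵥ x < b i)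
    (h₁ : ∀ i, ∃ x, u ⬝ᵥ x = c ∧ a i ⬝ᵥ x = b i ∧ ∀ j ≠ i, a j ⬝ᵥ x < b j) :
    IsMinimalIneqDescription (ineqSolutions {x | u ⬝ᵥ x = c} a b) {x | u ⬝ᵥ x = c} a b := by
  classical
  obtain ⟨x₀, hx₀u, hx₀⟩ := h₀
  choose x hxu hxeq hxlt using h₁
  set P := ineqSolutions {x | u ⬝ᵥ x = c} a b with hP
  have hPt : P = tightSolutions u c a b ∅ := by
    ext y; simp [tightSolutions, hP]
  have hFt : ∀ i, {y | y ∈ P ∧ a i ⬝ᵥ y = b i} = tightSolutions u c a b {i} := by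
    intro i; ext y; simp [tightSolutions, hP]
  have hx₀P : x₀ ∈ P := ⟨hx₀u, fun i => (hx₀ i).le⟩
  have hxP : ∀ i, x i ∈ P := fun i => ⟨hxu i, fun j => by
    by_cases hj : j = i
    · subst hj; exact (hxeq j).le
    · exact (hxlt i j hj).le⟩
  have hspanP : vectorSpan ℝ P = commonKer u a ∅ := by
    rw [hPt] at hx₀P ⊢
    exact vectorSpan_tightSolutions hx₀P fun i _ => hx₀ i
  have hspanF : ∀ i, vectorSpan ℝ {y | y ∈ P ∧ a i ⬝ᵥ y = b i} = commonKer u a {i} := by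
    intro i
    rw [hFt]
    refine vectorSpan_tightSolutions (x := x i) ?_ fun j hj => hxlt i j hj
    rw [← hFt]
    exact ⟨hxP i, hxeq i⟩
  have hdim : ∀ i, Module.finrank ℝ (commonKer u a {i}) + 1
      = Module.finrank ℝ (commonKer u a ∅) := by
    intro i
    refine finrank_commonKer_singleton (w := x₀ - x i) ?_ ?_
    · rw [dotProduct_sub, hx₀u, hxu, sub_self]
    · rw [dotProduct_sub, hxeq]
      exact (sub_neg.2 (hx₀ i)).ne
  have hbij : Set.BijOn (fun i => {y | y ∈ P ∧ a i ⬝ᵥ y = b i}) Set.univ {F | IsFacet P F} := by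
    refine ⟨fun i _ => ⟨fun _ => ?_, ⟨x i, hxP i, hxeq i⟩, ?_⟩, fun i _ j _ hij => ?_, ?_⟩
    · refine ⟨LinearMap.toContinuousLinearMap (dotFunctional (a i)), ?_⟩
      ext y
      simp only [Set.mem_ofPred_eq, LinearMap.coe_toContinuousLinearMap', dotFunctional_apply]
      refine and_congr_right fun hy => ⟨fun h z hz => h ▸ hz.2 i, fun h => ?_⟩
      exact le_antisymm (hy.2 i) (hxeq i ▸ h _ (hxP i))
    · simp only [polyDim]
      rw [hspanF, hspanP, hdim]
    · by_contra hne
      have : x i ∈ {y | y ∈ P ∧ a j ⬝ᵥ y = b j} := by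
        simp only at hij
        rw [← hij]
        exact ⟨hxP i, hxeq i⟩
      exact (hxlt i j (Ne.symm hne)).ne this.2
    · rintro F ⟨hF, hne, hFdim⟩
      -- If `l` is constant on a subset of `P` containing `F`, all of that subset consists of
      -- maximizers.
      have hconst : ∀ l : StrongDual ℝ (Fin n → ℝ), F = {x ∈ P | ∀ y ∈ P, l y ≤ l x} →
          ∀ G : Set (Fin n → ℝ), F ⊆ G → G ⊆ P →
          (∀ w ∈ vectorSpan ℝ G, l w = 0) → G ⊆ F := by
        intro l hl G hFG hGP hG y hy
        obtain ⟨z, hz⟩ := hne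
        have hyz : l y = l z := by
          have := hG _ (vsub_mem_vectorSpan ℝ hy (hFG hz))
          rw [vsub_eq_sub, map_sub] at this
          linarith
        rw [hl] at hz ⊢
        exact ⟨hGP hy, fun t ht => hyz ▸ hz.2 t ht⟩
      obtain ⟨l, hl⟩ := hF hne
      have hFP : F ⊆ P := hF.subset
      have hlF : ∀ w ∈ vectorSpan ℝ F, l w = 0 := by
        intro w hw
        rw [vectorSpan_def] at hw
        induction hw using Submodule.span_induction with
        | mem w hw =>
          obtain ⟨y, hy, z, hz, rfl⟩ := hw
          rw [hl] at hy hz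
          have h1 := hy.2 z hz.1
          have h2 := hz.2 y hy.1
          beta_reduce
          rw [vsub_eq_sub, map_sub]
          linarith
        | zero => simp
        | add p q _ _ hp hq => rw [map_add, hp, hq, add_zero]
        | smul r p _ hp => rw [map_smul, hp, smul_zero]
      -- Otherwise `F` has a point with slack everywhere. A maximum there forces `l` to vanish on
      -- all directions of `P`, so `F = P`, against the dimension.
      have hex : ∃ i, ∀ y ∈ F, a i ⬝ᵥ y = b i := by
        by_contra! hcon
        obtain ⟨z, hzF, hz⟩ := exists_strict_of_isExposed hF hne hcon
        have hle : ∀ w ∈ commonKer u a ∅, l w ≤ 0 := by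
          intro w hw
          obtain ⟨ε, hε, h⟩ := exists_pos_forall_lt (fun i => a i ⬝ᵥ w)
            (fun i => b i - a i ⬝ᵥ z) (fun i => sub_pos.2 (hz i))
          have hmem : z + ε • w ∈ P := by
            have hzu : u ⬝ᵥ z = c := (hFP hzF).1
            refine ⟨?_, fun i => ?_⟩
            · simp [dotProduct_add, dotProduct_smul, (mem_commonKer.1 hw).1, hzu]
            · have := h i
              simp only [dotProduct_add, dotProduct_smul, smul_eq_mul]
              linarith
          rw [hl] at hzF
          have := hzF.2 _ hmem
          rw [map_add, map_smul, smul_eq_mul] at this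
          by_contra! hpos
          nlinarith [mul_pos hε hpos]
        have hPF : P ⊆ F := by
          refine hconst l hl P hFP subset_rfl fun w hw => ?_
          rw [hspanP] at hw
          have := hle _ (Submodule.neg_mem _ hw)
          rw [map_neg] at this
          linarith [hle w hw]
        rw [hFP.antisymm hPF] at hFdim
        omega
      obtain ⟨i, hi⟩ := hex
      have hFi : F ⊆ {y | y ∈ P ∧ a i ⬝ᵥ y = b i} := fun y hy => ⟨hFP hy, hi y hy⟩
      refine ⟨i, trivial, (hFi.antisymm (hconst l hl _ hFi (fun y hy => hy.1) ?_)).symm⟩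
      -- Equal dimensions make the spans equal, so `l`, constant on `F`, is constant on the whole
      -- face of `i`.
      have hspan : vectorSpan ℝ F = vectorSpan ℝ {y | y ∈ P ∧ a i ⬝ᵥ y = b i} := by
        apply Submodule.eq_of_le_of_finrank_eq (vectorSpan_mono ℝ hFi)
        have := hdim i
        simp only [polyDim] at hFdim
        rw [hspanP] at hFdim
        rw [hspanF]
        omega
      rw [← hspan]
      exact hlF
  refine ⟨rfl, ?_, hbij⟩
  rw [← hbij.image_eq, hbij.injOn.ncard_image, Set.ncard_univ]

end Polyhedra

/-! ### Convexity of partial sums -/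

section Loday

variable {n : ℕ}

lemma partialSum_zero (α : Fin n → ℝ) : partialSum α 0 = 0 := by simp [partialSum]

lemma partialSum_succ (α : Fin n → ℝ) {t : ℕ} (ht : t < n) :
    partialSum α (t + 1) = partialSum α t + α ⟨t, ht⟩ := by
  have : (Finset.univ.filter fun k : Fin n => k.val < t + 1)
      = insert ⟨t, ht⟩ (Finset.univ.filter fun k : Fin n => k.val < t) := by
    ext k
    simp only [Finset.mem_filter, Finset.mem_univ, true_and, Finset.mem_insert, Fin.ext_iff]
    omega
  rw [partialSum, this, Finset.sum_insert (by simp), add_comm, partialSum]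

lemma partialSum_self (α : Fin n → ℝ) : partialSum α n = ∑ i, α i := by
  simp [partialSum]

lemma sum_filter_le (α : Fin n → ℝ) (t : ℕ) :
    ∑ i : Fin n with t ≤ i.val, α i = ∑ i, α i - partialSum α t := by
  rw [partialSum, ← Finset.sum_filter_add_sum_filter_not Finset.univ (fun k : Fin n => k.val < t)]
  simp

lemma partialSum_sub_le {α : Fin n → ℝ} {a b : ℕ} (hab : a ≤ b) (hb : b ≤ n) {c : ℝ}
    (h : ∀ k : Fin n, k.val < b → α k ≤ c) :
    partialSum α b - partialSum α a ≤ ((b : ℝ) - a) * c := by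
  induction b, hab using Nat.le_induction with
  | base => simp
  | succ b hab ih =>
    rw [partialSum_succ α hb]
    have := ih (by omega) fun k hk => h k (by omega)
    have := h ⟨b, hb⟩ (by simp)
    push_cast
    linarith

lemma le_partialSum_sub {α : Fin n → ℝ} {a b : ℕ} (hab : a ≤ b) (hb : b ≤ n) {c : ℝ}
    (h : ∀ k : Fin n, a ≤ k.val → c ≤ α k) :
    ((b : ℝ) - a) * c ≤ partialSum α b - partialSum α a := by
  induction b, hab using Nat.le_induction with
  | base => simp
  | succ b hab ih =>
    rw [partialSum_succ α hb]
    have := ih (by omega)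
    have := h ⟨b, hb⟩ hab
    push_cast
    linarith

/-- Strict convexity of the partial sums of a strictly increasing sequence. -/
lemma partialSum_chord_lt {α : Fin n → ℝ} (hα : StrictMono α) {a b c : ℕ} (hab : a < b)
    (hbc : b < c) (hc : c ≤ n) :
    ((c : ℝ) - a) * partialSum α b
      < ((c : ℝ) - b) * partialSum α a + ((b : ℝ) - a) * partialSum α c := by
  -- With indices from 0, `α ⟨b - 1, _⟩` is the largest increment before `b` and `α ⟨b, _⟩` the
  -- smallest after it.
  have h1 := partialSum_sub_le (α := α) (c := α ⟨b - 1, by omega⟩) hab.le (by omega) fun k hk =>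
    hα.monotone (Fin.mk_le_mk.2 (by omega) : (⟨k, k.2⟩ : Fin n) ≤ _)
  have h2 := le_partialSum_sub (α := α) (c := α ⟨b, by omega⟩) hbc.le hc fun k hk =>
    hα.monotone (Fin.mk_le_mk.2 hk : _ ≤ (⟨k, k.2⟩ : Fin n))
  have h3 : α ⟨b - 1, by omega⟩ < α ⟨b, by omega⟩ := hα (Fin.mk_lt_mk.2 (by omega))
  have hab' : (0 : ℝ) < b - a := sub_pos.2 (by exact_mod_cast hab)
  have hbc' : (0 : ℝ) < c - b := sub_pos.2 (by exact_mod_cast hbc)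
  nlinarith [mul_le_mul_of_nonneg_left h1 hbc'.le, mul_le_mul_of_nonneg_left h2 hab'.le,
    mul_lt_mul_of_pos_left h3 (mul_pos hab' hbc')]

lemma partialSum_add_sub_mono {α : Fin n → ℝ} (hα : Monotone α) {a b k : ℕ} (hab : a ≤ b)
    (hb : b + k ≤ n) :
    partialSum α (a + k) - partialSum α a ≤ partialSum α (b + k) - partialSum α b := by
  induction k with
  | zero => simp
  | succ k ih =>
    rw [← add_assoc, ← add_assoc, partialSum_succ α (t := a + k) (by omega),
      partialSum_succ α (t := b + k) (by omega)]
    have : α ⟨a + k, by omega⟩ ≤ α ⟨b + k, by omega⟩ := hα (Fin.mk_le_mk.2 (by omega))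
    linarith [ih (by omega)]

/-- The root coordinate f(p+1+q) - f(p) - f(q) grows with both subtree sizes: enlarge `p'` to `p`
with a window of length `1 + q'`, then `q'` to `q` with one of length `1 + p`. -/
lemma partialSum_supermodular {α : Fin n → ℝ} (hα : Monotone α) {p q p' q' : ℕ} (hp : p' ≤ p)
    (hq : q' ≤ q) (h : p + 1 + q ≤ n) :
    partialSum α (p' + 1 + q') + partialSum α p + partialSum α q
      ≤ partialSum α (p + 1 + q) + partialSum α p' + partialSum α q' := by
  have h1 := partialSum_add_sub_mono hα (k := 1 + q') hp (by omega)
  have h2 := partialSum_add_sub_mono hα (k := 1 + p) hq (by omega)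
  rw [← add_assoc, ← add_assoc] at h1
  rw [show q' + (1 + p) = p + 1 + q' by omega, show q + (1 + p) = p + 1 + q by omega] at h2
  linarith

/-! ### Sums of coordinates of a vertex -/

/-- The coordinates of `v_T^α`, for `T` of any size and with labels starting from `0`. -/
def treeCoord (α : Fin n → ℝ) (T : BinaryTree Unit) (i : ℕ) : ℝ :=
  treeVal α (subtreeAt T (i + 1))

lemma treeCoord_node_of_lt (α : Fin n → ℝ) {u : Unit} {l r : BinaryTree Unit} {i : ℕ}
    (hi : i < l.numNodes) : treeCoord α (.node u l r) i = treeCoord α l i := by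
  rw [treeCoord, subtreeAt, if_pos (by rw [BinaryTree.numLeaves_eq_numNodes_succ]; omega)]
  rfl

lemma treeCoord_node_self (α : Fin n → ℝ) (u : Unit) (l r : BinaryTree Unit) :
    treeCoord α (.node u l r) l.numNodes = partialSum α (l.numNodes + 1 + r.numNodes)
      - partialSum α l.numNodes - partialSum α r.numNodes := by
  rw [treeCoord, subtreeAt, if_neg (by rw [BinaryTree.numLeaves_eq_numNodes_succ]; omega),
    if_neg (by rw [BinaryTree.numLeaves_eq_numNodes_succ]; omega), treeVal]
  simp only [BinaryTree.numNodes, BinaryTree.left, BinaryTree.right]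
  rw [add_right_comm]

lemma treeCoord_node_add (α : Fin n → ℝ) (u : Unit) (l r : BinaryTree Unit) (i : ℕ) :
    treeCoord α (.node u l r) (l.numNodes + 1 + i) = treeCoord α r i := by
  rw [treeCoord, subtreeAt, if_neg (by rw [BinaryTree.numLeaves_eq_numNodes_succ]; omega),
    if_pos (by rw [BinaryTree.numLeaves_eq_numNodes_succ]; omega),
    BinaryTree.numLeaves_eq_numNodes_succ, treeCoord]
  congr 2
  omega

lemma sum_Ico_treeCoord_left (α : Fin n → ℝ) (u : Unit) (l r : BinaryTree Unit) {a b : ℕ}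
    (hb : b ≤ l.numNodes) (g : ℕ → ℝ) :
    ∑ i ∈ Finset.Ico a b, g i * treeCoord α (.node u l r) i
      = ∑ i ∈ Finset.Ico a b, g i * treeCoord α l i :=
  Finset.sum_congr rfl fun i hi => by
    rw [treeCoord_node_of_lt α (by have := Finset.mem_Ico.1 hi; omega)]

lemma sum_Ico_add_left (p : ℕ) (F : ℕ → ℝ) {a b : ℕ} :
    ∑ i ∈ Finset.Ico (p + a) (p + b), F i = ∑ i ∈ Finset.Ico a b, F (p + i) := by
  rw [Finset.sum_Ico_add F a b p, add_comm p a, add_comm p b]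

lemma sum_Ico_treeCoord_right (α : Fin n → ℝ) (u : Unit) (l r : BinaryTree Unit) {a b : ℕ}
    (g : ℕ → ℝ) :
    ∑ i ∈ Finset.Ico (l.numNodes + 1 + a) (l.numNodes + 1 + b),
        g i * treeCoord α (.node u l r) i
      = ∑ i ∈ Finset.Ico a b, g (l.numNodes + 1 + i) * treeCoord α r i := by
  rw [sum_Ico_add_left]
  exact Finset.sum_congr rfl fun i _ => by rw [treeCoord_node_add]

lemma sum_Ico_split (F : ℕ → ℝ) {a p b : ℕ} (ha : a ≤ p) (hb : p < b) :
    ∑ i ∈ Finset.Ico a b, F i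
      = ∑ i ∈ Finset.Ico a p, F i + F p + ∑ i ∈ Finset.Ico (p + 1) b, F i := by
  rw [← Finset.sum_Ico_consecutive F ha hb.le, Finset.sum_eq_sum_Ico_succ_bot hb, add_assoc]

lemma numNodes_node (u : Unit) (l r : BinaryTree Unit) :
    (BinaryTree.node u l r).numNodes = l.numNodes + 1 + r.numNodes := by
  simp only [BinaryTree.numNodes]; omega

/-- The weight `g` is 1 for plain coordinate sums and a shifted cost in `exists_tree_cost_le`. -/
lemma sum_treeCoord_node (α : Fin n → ℝ) (u : Unit) (l r : BinaryTree Unit) (g : ℕ → ℝ)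
    {a b : ℕ} (ha : a ≤ l.numNodes) :
    ∑ i ∈ Finset.Ico a (l.numNodes + 1 + b), g i * treeCoord α (.node u l r) i
      = ∑ i ∈ Finset.Ico a l.numNodes, g i * treeCoord α l i
        + g l.numNodes * (partialSum α (l.numNodes + 1 + r.numNodes)
          - partialSum α l.numNodes - partialSum α r.numNodes)
        + ∑ i ∈ Finset.Ico 0 b, g (l.numNodes + 1 + i) * treeCoord α r i := by
  rw [sum_Ico_split _ ha (by omega), sum_Ico_treeCoord_left α u l r le_rfl, treeCoord_node_self,
    ← sum_Ico_treeCoord_right α u]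

lemma sum_treeCoord (α : Fin n → ℝ) (T : BinaryTree Unit) :
    ∑ i ∈ Finset.Ico 0 T.numNodes, treeCoord α T i = partialSum α T.numNodes := by
  induction T with
  | nil => simp [partialSum_zero]
  | node u l r hl hr =>
    have := sum_treeCoord_node α u l r 1 (b := r.numNodes) (Nat.zero_le _)
    simp only [Pi.one_apply, one_mul] at this
    rw [numNodes_node, this, hl, hr]
    ring

/-- The points `v_T^α` satisfy the inequalities. -/
lemma partialSum_le_sum_treeCoord {α : Fin n → ℝ} (hα : Monotone α) (T : BinaryTree Unit)
    (hT : T.numNodes ≤ n) {a b : ℕ} (hab : a ≤ b) (hb : b ≤ T.numNodes) :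
    partialSum α (b - a) ≤ ∑ i ∈ Finset.Ico a b, treeCoord α T i := by
  induction T generalizing a b with
  | nil =>
    obtain rfl : b = 0 := by simpa using hb
    simp [partialSum_zero]
  | node u l r hl hr =>
    rw [numNodes_node] at hT hb
    by_cases h1 : b ≤ l.numNodes
    · have := sum_Ico_treeCoord_left α u l r (a := a) h1 1
      simp only [Pi.one_apply, one_mul] at this
      rw [this]
      exact hl (by omega) hab h1
    obtain ⟨b, rfl⟩ := Nat.exists_eq_add_of_le (show l.numNodes + 1 ≤ b by omega)
    by_cases h2 : l.numNodes < a
    · obtain ⟨a, rfl⟩ := Nat.exists_eq_add_of_le (show l.numNodes + 1 ≤ a by omega)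
      have := sum_Ico_treeCoord_right α u l r (a := a) (b := b) 1
      simp only [Pi.one_apply, one_mul] at this
      rw [this, Nat.add_sub_add_left]
      exact hr (by omega) (by omega) (by omega)
    -- The interval contains the root: it is a final segment of the left subtree, the root, and the
    -- first `b` labels of the right subtree.
    · have := sum_treeCoord_node α u l r 1 (a := a) (b := b) (by omega)
      simp only [Pi.one_apply, one_mul] at this
      rw [this]
      have h3 := hl (by omega) (show a ≤ l.numNodes by omega) le_rfl
      have h4 := hr (by omega) (Nat.zero_le b) (by omega)
      have h5 := partialSum_supermodular hα (p := l.numNodes) (q := r.numNodes)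
        (p' := l.numNodes - a) (q' := b) (by omega) (by omega) hT
      rw [show l.numNodes + 1 + b - a = l.numNodes - a + 1 + b by omega]
      rw [Nat.sub_zero] at h4
      linarith

/-- For every cost vector `c`, some `v_T^α` minimizes the cost among all points that satisfy the
inequalities. The root of `T` is put at an entry where `c` is minimal. -/
lemma exists_tree_cost_le (α : Fin n → ℝ) (m : ℕ) (c x : ℕ → ℝ)
    (hx : ∀ a b, a ≤ b → b ≤ m → partialSum α (b - a) ≤ ∑ i ∈ Finset.Ico a b, x i) :
    ∃ T : BinaryTree Unit, T.numNodes = m ∧ ∀ s : ℝ, (∀ i < m, s ≤ c i) →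
      ∑ i ∈ Finset.Ico 0 m, (c i - s) * treeCoord α T i
        ≤ ∑ i ∈ Finset.Ico 0 m, (c i - s) * x i := by
  induction m using Nat.strong_induction_on generalizing c x with
  | _ m ih =>
  rcases Nat.eq_zero_or_pos m with rfl | hm
  · exact ⟨.nil, rfl, by simp⟩
  obtain ⟨p, hp, hmin⟩ := Finset.exists_min_image (Finset.range m) c ⟨0, by simpa⟩
  simp only [Finset.mem_range] at hp hmin
  obtain ⟨q, rfl⟩ := Nat.exists_eq_add_of_le (show p + 1 ≤ m by omega)
  obtain ⟨l, hl, hlc⟩ := ih p hp c x fun a b hab hb => hx a b hab (by omega)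
  obtain ⟨r, hr, hrc⟩ := ih q (by omega) (fun i => c (p + 1 + i)) (fun i => x (p + 1 + i))
    fun a b hab hb => by
      rw [← sum_Ico_add_left, ← Nat.add_sub_add_left (p + 1) b a]
      exact hx _ _ (by omega) (by omega)
  -- Shifting by the root's cost keeps the weights on both sides nonnegative and kills the root
  -- term.
  have hl' := hlc (c p) fun i hi => hmin i (by omega)
  have hr' := hrc (c p) fun i hi => hmin _ (by omega)
  subst hl hr
  refine ⟨.node () l r, numNodes_node _ _ _, fun s hs => ?_⟩
  -- Write c i - s as (c p - s) + (c i - c p). The first part is a nonnegative multiple of the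
  -- total, which is minimal for the tree; the second splits over the subtrees.
  have key : ∀ y : ℕ → ℝ, ∑ i ∈ Finset.Ico 0 (l.numNodes + 1 + r.numNodes), (c i - s) * y i
      = (c l.numNodes - s) * ∑ i ∈ Finset.Ico 0 (l.numNodes + 1 + r.numNodes), y i
        + ∑ i ∈ Finset.Ico 0 (l.numNodes + 1 + r.numNodes), (c i - c l.numNodes) * y i := by
    intro y
    rw [Finset.mul_sum, ← Finset.sum_add_distrib]
    exact Finset.sum_congr rfl fun i _ => by ring
  rw [key, key x]
  have hT := sum_treeCoord α (.node () l r)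
  rw [numNodes_node] at hT
  rw [hT]
  apply add_le_add
  · exact mul_le_mul_of_nonneg_left (hx 0 _ (Nat.zero_le _) le_rfl) (sub_nonneg.2 (hs _ hp))
  · rw [sum_treeCoord_node α () l r (fun i => c i - c l.numNodes) (Nat.zero_le _),
      sum_Ico_split (fun i => (c i - c l.numNodes) * x i) (Nat.zero_le _) hp]
    have := sum_Ico_add_left (l.numNodes + 1) (fun i => (c i - c l.numNodes) * x i)
      (a := 0) (b := r.numNodes)
    rw [add_zero] at this
    rw [this]
    simp only [sub_self, zero_mul, add_zero]
    exact add_le_add hl' hr'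

end Loday

/-! ### The interval polytope equals the Loday associahedron -/

section Loday

variable {n : ℕ}

lemma sum_Icc_fin (a b : Fin n) (X : ℕ → ℝ) :
    ∑ i ∈ Finset.Icc a b, X i.val = ∑ i ∈ Finset.Ico a.val (b.val + 1), X i := by
  have : Finset.Ico a.val (b.val + 1) = (Finset.Icc a b).map Fin.valEmbedding := by
    rw [Fin.map_valEmbedding_Icc]
    ext k
    simp only [Finset.mem_Ico, Finset.mem_Icc]
    omega
  rw [this, Finset.sum_map]
  rfl

lemma indicatorVec_dotProduct (S : Finset (Fin n)) (x : Fin n → ℝ) :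
    indicatorVec S ⬝ᵥ x = ∑ i ∈ S, x i := by
  rw [indicatorVec, sum_dotProduct]
  simp

lemma mem_sumHyperplane {α x : Fin n → ℝ} :
    x ∈ sumHyperplane α ↔ ∑ i, x i = ∑ i, α i := by
  rw [← one_dotProduct]; rfl

/-- In the hyperplane, the inequality of `I` bounds the sum over `I` from below. -/
lemma indicatorVec_compl_sub {α x : Fin n → ℝ} (hx : x ∈ sumHyperplane α)
    (I : Finset (Fin n)) :
    indicatorVec Iᶜ ⬝ᵥ x - ∑ i : Fin n with I.card ≤ i.val, α i
      = partialSum α I.card - ∑ i ∈ I, x i := by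
  rw [indicatorVec_dotProduct, sum_filter_le]
  have := Finset.sum_add_sum_compl I x
  rw [mem_sumHyperplane] at hx
  linarith

/-- The solution set of the inequalities of the proper intervals. -/
abbrev intervalPolytope (α : Fin n → ℝ) : Set (Fin n → ℝ) :=
  ineqSolutions (sumHyperplane α) (fun I : ProperInterval n => indicatorVec (I.val)ᶜ)
    (fun I : ProperInterval n => ∑ i : Fin n with I.val.card ≤ i.val, α i)

lemma mem_intervalPolytope {α x : Fin n → ℝ} :
    x ∈ intervalPolytope α ↔ ∑ i, x i = ∑ i, α i ∧
      ∀ I : ProperInterval n, partialSum α I.val.card ≤ ∑ i ∈ I.val, x i := by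
  rw [← mem_sumHyperplane]
  refine and_congr_right fun hx => forall_congr' fun I => ?_
  have := indicatorVec_compl_sub hx I.val
  rw [← sub_nonpos, this, sub_nonpos]

lemma convex_intervalPolytope (α : Fin n → ℝ) : Convex ℝ (intervalPolytope α) := by
  intro x hx y hy s t hs ht hst
  rw [mem_intervalPolytope] at *
  simp only [Pi.add_apply, Pi.smul_apply, smul_eq_mul, Finset.sum_add_distrib, ← Finset.mul_sum]
  refine ⟨by rw [hx.1, hy.1, ← add_mul, hst, one_mul], fun I => ?_⟩
  calc partialSum α I.val.card = s * partialSum α I.val.card + t * partialSum α I.val.card := by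
        rw [← add_mul, hst, one_mul]
    _ ≤ _ := add_le_add (mul_le_mul_of_nonneg_left (hx.2 I) hs)
        (mul_le_mul_of_nonneg_left (hy.2 I) ht)

lemma lodayVertex_mem_intervalPolytope {α : Fin n → ℝ} (hα : Monotone α) {T : BinaryTree Unit}
    (hT : T.numNodes = n) : lodayVertex α T ∈ intervalPolytope α := by
  rw [mem_intervalPolytope]
  constructor
  · have := sum_treeCoord α T
    rw [hT, partialSum_self, ← Finset.range_eq_Ico, ← Fin.sum_univ_eq_sum_range] at this
    exact this
  · rintro ⟨I, ⟨a, b, rfl⟩, hne, -⟩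
    have hab : a ≤ b := Finset.nonempty_Icc.1 hne
    have h := partialSum_le_sum_treeCoord hα T hT.le (a := a.val) (b := b.val + 1)
      (by omega) (by omega)
    rw [← sum_Icc_fin] at h
    rw [Fin.card_Icc]
    exact h

/-- The induction over trees also meets the empty interval, where both sides are 0, and the full
one, where the hyperplane equation applies. -/
lemma partialSum_le_sum_Ico {α x : Fin n → ℝ} (hx : x ∈ intervalPolytope α) {X : ℕ → ℝ}
    (hX : ∀ i : Fin n, X i.val = x i) {a b : ℕ} (hab : a ≤ b) (hb : b ≤ n) :
    partialSum α (b - a) ≤ ∑ i ∈ Finset.Ico a b, X i := by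
  rw [mem_intervalPolytope] at hx
  rcases hab.eq_or_lt with rfl | hab
  · simp [partialSum_zero]
  by_cases h : a = 0 ∧ b = n
  · obtain ⟨rfl, rfl⟩ := h
    rw [← Finset.range_eq_Ico, ← Fin.sum_univ_eq_sum_range, Nat.sub_zero, partialSum_self]
    simp only [hX]
    exact hx.1.ge
  · have hcard : (Finset.Icc (⟨a, by omega⟩ : Fin n) ⟨b - 1, by omega⟩).card = b - a := by
      rw [Fin.card_Icc]
      simp only
      omega
    have := hx.2 ⟨Finset.Icc ⟨a, by omega⟩ ⟨b - 1, by omega⟩, ⟨_, _, rfl⟩,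
      Finset.nonempty_Icc.2 (Fin.mk_le_mk.2 (by omega)), fun hu => by
        rw [hu, Finset.card_univ, Fintype.card_fin] at hcard
        omega⟩
    simp only [hcard, ← hX] at this
    rw [sum_Icc_fin] at this
    simp only [show b - 1 + 1 = b by omega] at this
    exact this

lemma isClosed_LodAsso (α : Fin n → ℝ) : IsClosed (LodAsso α) := by
  refine IsCompact.isClosed (Set.Finite.isCompact_convexHull ℝ ?_)
  refine ((BinaryTree.treesOfNumNodesEq n).finite_toSet.image (lodayVertex α)).subset ?_
  rintro _ ⟨T, hT, rfl⟩
  exact ⟨T, by simpa using hT, rfl⟩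

theorem LodAsso_eq_intervalPolytope {α : Fin n → ℝ} (hα : Monotone α) :
    LodAsso α = intervalPolytope α := by
  apply Set.Subset.antisymm
  · refine convexHull_min ?_ (convex_intervalPolytope α)
    rintro _ ⟨T, hT, rfl⟩
    exact lodayVertex_mem_intervalPolytope hα hT
  · intro x hx
    by_contra hnot
    obtain ⟨l, v, hlx, hl⟩ := geometric_hahn_banach_point_closed (convex_convexHull ℝ _)
      (isClosed_LodAsso α) hnot
    let ext : (Fin n → ℝ) → ℕ → ℝ := fun y i => if h : i < n then y ⟨i, h⟩ else 0
    have hext : ∀ y (i : Fin n), ext y i.val = y i := fun y i => by simp [ext]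
    let c : Fin n → ℝ := fun i => l (Pi.single i 1)
    have hlc : ∀ y : Fin n → ℝ, l y = ∑ i, c i * y i := by
      intro y
      conv_lhs => rw [pi_eq_sum_univ' y]
      rw [map_sum]
      refine Finset.sum_congr rfl fun i _ => ?_
      rw [map_smul, smul_eq_mul, mul_comm]
    obtain ⟨T, hT, hcost⟩ := exists_tree_cost_le α n (ext c) (ext x)
      fun a b hab hb => partialSum_le_sum_Ico hx (hext x) hab hb
    -- Any lower bound of the costs will do: the tree point and `x` have equal coordinate sums, so
    -- `s` cancels.
    obtain ⟨s, hs⟩ : ∃ s, ∀ i, s ≤ c i := by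
      obtain ⟨s, hs⟩ := (Set.finite_range c).bddBelow
      exact ⟨s, fun i => hs ⟨i, rfl⟩⟩
    have h := hcost s fun i hi => by simpa [ext, hi] using hs ⟨i, hi⟩
    simp only [← Finset.range_eq_Ico] at h
    rw [← Fin.sum_univ_eq_sum_range (fun i => (ext c i - s) * treeCoord α T i),
      ← Fin.sum_univ_eq_sum_range (fun i => (ext c i - s) * ext x i)] at h
    simp only [hext, sub_mul, Finset.sum_sub_distrib, ← Finset.mul_sum] at h
    have hv := lodayVertex_mem_intervalPolytope hα hT
    have h1 := (mem_intervalPolytope.1 hv).1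
    have h2 := (mem_intervalPolytope.1 hx).1
    have h3 := hl _ (subset_convexHull ℝ _ ⟨T, hT, rfl⟩)
    rw [hlc] at h3 hlx
    change _ - s * ∑ i, lodayVertex α T i ≤ _ at h
    rw [h1, h2] at h
    change ∑ i, c i * lodayVertex α T i - _ ≤ _ at h
    linarith

/-! ### Points at which prescribed inequalities are strict -/

/-- The mean of the entries of `α` is a strict solution. -/
lemma exists_strict_solution {α : Fin n → ℝ} (hα : StrictMono α) :
    ∃ x : Fin n → ℝ, ∑ i, x i = ∑ i, α i ∧
      ∀ I : ProperInterval n, partialSum α I.val.card < ∑ i ∈ I.val, x i := by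
  refine ⟨fun _ => (∑ i, α i) / n, ?_, ?_⟩
  · rcases Nat.eq_zero_or_pos n with rfl | hn
    · simp
    · have : (n : ℝ) ≠ 0 := by positivity
      simp only [Finset.sum_const, Finset.card_univ, Fintype.card_fin, nsmul_eq_mul]
      field_simp
  · rintro ⟨I, -, hne, hu⟩
    have hpos := hne.card_pos
    have hlt : I.card < n := by simpa using (Finset.card_lt_iff_ne_univ I).2 hu
    -- The chord of f from 0 to n lies strictly above f at |I|.
    have h := partialSum_chord_lt hα hpos hlt le_rfl
    have hn : (0 : ℝ) < n := by exact_mod_cast hpos.trans hlt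
    rw [partialSum_zero, partialSum_self] at h
    simp only [Finset.sum_const, nsmul_eq_mul]
    rw [← mul_div_assoc, lt_div_iff₀ hn]
    simp only [Nat.cast_zero, sub_zero, mul_zero, zero_add] at h
    linarith

/-- Averaging `α` over its first `|I|` entries and over the others gives a solution at which only
the inequality of `I` is tight. -/
lemma exists_tight_solution {α : Fin n → ℝ} (hα : StrictMono α) {I : Finset (Fin n)}
    (hne : I.Nonempty) (hu : I ≠ Finset.univ) :
    ∃ x : Fin n → ℝ, ∑ i, x i = ∑ i, α i ∧ ∑ i ∈ I, x i = partialSum α I.card ∧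
      ∀ J : Finset (Fin n), J.Nonempty → J ≠ Finset.univ → J ≠ I →
        partialSum α J.card < ∑ i ∈ J, x i := by
  have hpos := hne.card_pos
  have hlt : I.card < n := by simpa using (Finset.card_lt_iff_ne_univ I).2 hu
  have hm : (0 : ℝ) < I.card := by exact_mod_cast hpos
  have hmn : (0 : ℝ) < n - I.card := sub_pos.2 (by exact_mod_cast hlt)
  -- `β` and `γ` are the slopes of the chords of f over [0, |I|] and [|I|, n].
  obtain ⟨β, hβ⟩ : ∃ β, I.card * β = partialSum α I.card :=
    ⟨partialSum α I.card / I.card, by field_simp⟩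
  obtain ⟨γ, hγ⟩ : ∃ γ, ((n : ℝ) - I.card) * γ = partialSum α n - partialSum α I.card :=
    ⟨(partialSum α n - partialSum α I.card) / (n - I.card), by field_simp⟩
  have hβγ : β < γ := by
    have h := partialSum_chord_lt hα hpos hlt le_rfl
    rw [partialSum_zero, ← hβ, eq_add_of_sub_eq hγ.symm, ← hβ] at h
    simp only [Nat.cast_zero, sub_zero, mul_zero, zero_add] at h
    have : 0 < (I.card * (n - I.card)) * (γ - β) := by linarith
    exact sub_pos.1 (pos_of_mul_pos_right this (by positivity))
  have hsum : ∀ J : Finset (Fin n), ∑ i ∈ J, (if i ∈ I then β else γ)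
      = (J ∩ I).card * β + (J \ I).card * γ := by
    intro J
    rw [Finset.sum_ite, Finset.filter_mem_eq_inter, Finset.filter_notMem_eq_sdiff]
    simp
  refine ⟨fun i => if i ∈ I then β else γ, ?_, ?_, fun J hJ hJu hJI => ?_⟩
  · rw [hsum, ← partialSum_self, Finset.univ_inter, ← Finset.compl_eq_univ_sdiff,
      Finset.card_compl, Fintype.card_fin, Nat.cast_sub hlt.le, hβ, hγ]
    ring
  · rw [hsum, Finset.inter_self, Finset.sdiff_self, hβ]
    simp
  · rw [hsum]
    have hJpos := hJ.card_pos
    have hJlt : J.card < n := by simpa using (Finset.card_lt_iff_ne_univ J).2 hJu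
    have hadd : ((J ∩ I).card : ℝ) + (J \ I).card = J.card := by
      exact_mod_cast Finset.card_inter_add_card_sdiff J I
    have hle : ((J ∩ I).card : ℝ) ≤ I.card := by
      exact_mod_cast Finset.card_le_card Finset.inter_subset_right
    -- The sum over J is at least the height at |J| of the broken line formed by the two chords,
    -- which exceeds f(|J|) unless |J| = |I|. In that case J ≠ I has an element outside I, and `β <
    -- γ` gives strictness.
    rcases lt_trichotomy J.card I.card with h | h | h
    · have hc := partialSum_chord_lt hα hJpos h hlt.le
      rw [partialSum_zero, ← hβ] at hc
      simp only [Nat.cast_zero, sub_zero, mul_zero, zero_add] at hc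
      have : partialSum α J.card < J.card * β := by
        have : (I.card : ℝ) * partialSum α J.card < I.card * (J.card * β) := by linarith
        exact lt_of_mul_lt_mul_left this hm.le
      rw [← hadd] at this
      nlinarith [mul_le_mul_of_nonneg_left hβγ.le (Nat.cast_nonneg (α := ℝ) (J \ I).card)]
    · have hsd : 0 < (J \ I).card := by
        rw [Finset.card_pos, Finset.sdiff_nonempty]
        exact fun hs => hJI (Finset.eq_of_subset_of_card_le hs h.ge)
      have hsd' : (0 : ℝ) < (J \ I).card := by exact_mod_cast hsd
      rw [h, ← hβ, ← h, ← hadd]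
      nlinarith [mul_lt_mul_of_pos_left hβγ hsd']
    · have hc := partialSum_chord_lt hα h hJlt le_rfl
      rw [eq_add_of_sub_eq hγ.symm] at hc
      have : partialSum α J.card < partialSum α I.card + (J.card - I.card) * γ := by
        have : ((n : ℝ) - I.card) * partialSum α J.card
            < (n - I.card) * (partialSum α I.card + (J.card - I.card) * γ) := by linarith
        exact lt_of_mul_lt_mul_left this hmn.le
      rw [← hβ, ← hadd] at this
      nlinarith [mul_le_mul_of_nonneg_left hβγ.le (sub_nonneg.2 hle)]

end Loday

/-- In the right-hand sides, `∑_{i=|I|+1}^{d+1} α_i` is the sum over the elements of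
`Fin (d + 1)` whose value is at least `|I|`. -/
theorem theorem4p11 (d : ℕ) (α : Fin (d + 1) → ℝ) (hα : StrictMono α) :
    IsMinimalIneqDescription (LodAsso α) (sumHyperplane α)
      (fun I : ProperInterval (d + 1) => indicatorVec (I.val)ᶜ)
      (fun I : ProperInterval (d + 1) =>
        ∑ i : Fin (d + 1) with I.val.card ≤ i.val, α i) := by
  rw [LodAsso_eq_intervalPolytope hα.monotone]
  apply isMinimalIneqDescription_of_strict
  · obtain ⟨x, hx, hlt⟩ := exists_strict_solution hα
    have hmem := mem_sumHyperplane.2 hx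
    refine ⟨x, hmem, fun I => ?_⟩
    rw [← sub_neg, indicatorVec_compl_sub hmem, sub_neg]
    exact hlt I
  · intro I
    obtain ⟨x, hx, heq, hlt⟩ := exists_tight_solution hα I.2.2.1 I.2.2.2
    have hmem := mem_sumHyperplane.2 hx
    refine ⟨x, hmem, ?_, fun J hJ => ?_⟩
    · rw [← sub_eq_zero, indicatorVec_compl_sub hmem, heq, sub_self]
    · rw [← sub_neg, indicatorVec_compl_sub hmem, sub_neg]
      exact hlt J.val J.2.2.1 J.2.2.2 fun h => hJ (Subtype.ext h)
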